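/- Let $\mathcal{O}$ be a Dedekind domain with fraction field $K$ such that $\mathcal{O}/\mathfrak{a}$ is finite for every nonzero ideal $\mathfrak{a}$. Let $S \subseteq \mathcal{O}$ be a multiplicative subset with $0 \notin S$ such that the localization $\mathcal{O}_S \subseteq K$ is not a field. Let $c_1, \dots, c_n \in \mathcal{O}^{\ell}$ be column vectors, $\mathcal{A} = \{c_1, \dots, c_n\}$, and let $\mathcal{A}_S$ be $\mathcal{A}$ regarded as a subset of $\mathcal{O}_S^{\ell}$. Let $\pi \colon K^{\ell} \to (K/\mathcal{O})^{\ell}$ be the projection. For $J \subseteq [n]$ put $H_J = \{x \in K^{\ell} \mid x c_j = 0 \ (j \in J)\}$ and $T_J = \bigcap_{j \in J} \{\pi(x) \mid x \in K^{\ell},\ x c_j \in \mathcal{O}\} \subseteq (K/\mathcal{O})^{\ell}$ (so $H_\varnothing = K^{\ell}$, $T_\varnothing = (K/\mathcal{O})^{\ell}$). The poset of layers is $$L(\mathcal{A}(K/\mathcal{O})) = \{ z + \pi(H_J) \mid J \subseteq [n],\ z \in T_J \},$$ ordered by reverse inclusion. For an ideal $\kappa$ of $\mathcal{O}$, let $L(\mathcal{A}(K/\mathcal{O}))[\kappa]$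 be the subposet of the $\kappa$-torsion layers, i.e. those $z + \pi(H_J)$ with $z \in T_J$ such that $az \in \pi(H_J)$ for all $a \in \kappa$. For nonempty $J$ let $\phi_J \colon \mathcal{O}^{\ell} \to \mathcal{O}^{J}$, $x \mapsto (x c_j)_{j \in J}$, and let $\mathfrak{d}_J$ be the largest invariant factor of $\operatorname{coker} \phi_J$: if $\operatorname{coker}\phi_J \simeq \bigoplus_{i=1}^{r} \mathcal{O}/\mathfrak{d}_{J,i} \oplus F$ with $F$ torsion-free, $\mathfrak{d}_{J,i} \neq 0$ and $\mathfrak{d}_{J,i} \mid \mathfrak{d}_{J,i+1}$, then $\mathfrak{d}_J = \mathfrak{d}_{J,r}$, and $\mathfrak{d}_J = \mathcal{O}$ if $r = 0$ (equivalently, $\mathfrak{d}_J$ is the annihilator of the torsion submodule of $\operatorname{coker} \phi_J$). The LCM-period is $\rho_{\mathcal{A}} = \operatorname{lcm}\{\mathfrak{d}_J \mid \varnothing \neq J \subseteq [n]\}$. The same notions are used for $\mathcal{A}_S$ over $\mathcal{O}_S$. Let $\eta_S \colon (K/\mathcal{O})^{\ell} \to (K/\mathcal{O}_S)^{\ell}$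 be the canonical homomorphism; $Z \mapsto \eta_S(Z)$ is an order-preserving map $L(\mathcal{A}(K/\mathcal{O})) \to L(\mathcal{A}_S(K/\mathcal{O}_S))$. **Theorem.** For every ideal $\delta$ of $\mathcal{O}_S$ with $\delta \mid \rho_{\mathcal{A}_S}$, the map $Z \mapsto \eta_S(Z)$ restricts to an isomorphism of finite posets $$L(\mathcal{A}(K/\mathcal{O}))[\delta \cap \mathcal{O}] \longrightarrow L(\mathcal{A}_S(K/\mathcal{O}_S))[\delta].$$ In particular, $L(\mathcal{A}_S(K/\mathcal{O}_S)) \simeq L(\mathcal{A}(K/\mathcal{O}))[\rho_{\mathcal{A}}\mathcal{O}_S \cap \mathcal{O}]$ as posets. -/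

import Mathlib

/-!
A finite family `c = (c_1, …, c_n)` of vectors of `R ^ ℓ` over a Dedekind domain `R` with fraction
field `K`: the torsion arrangement in `(K / R) ^ ℓ`, its poset of layers, the torsion subposets and
the LCM-period.
-/

namespace TorsionArrangement

section Base

variable (R K : Type*) [CommRing R] [Field K] [Algebra R K]

/-- The `R`-module `K / R`. -/
abbrev FracQuot : Type _ := K ⧸ LinearMap.range (Algebra.linearMap R K)

/-- The coordinatewise projection `π : K ^ ℓ → (K / R) ^ ℓ`. -/
def proj (ℓ : ℕ) : (Fin ℓ → K) →ₗ[R] (Fin ℓ → FracQuot R K) :=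
  (Submodule.mkQ (LinearMap.range (Algebra.linearMap R K))).compLeft (Fin ℓ)

variable {R} {n ℓ : ℕ} (c : Fin n → Fin ℓ → R)

/-- The pairing `x ↦ x c_j` of a row vector `x` over `K` with `c_j`. -/
def pairing (j : Fin n) : (Fin ℓ → K) →ₗ[K] K where
  toFun x := ∑ i, x i * algebraMap R K (c j i)
  map_add' x y := by simp [add_mul, Finset.sum_add_distrib]
  map_smul' a x := by simp [Finset.mul_sum, mul_assoc]

/-- The hyperplane `H_j = {x ∈ K ^ ℓ | x c_j = 0}`. -/
def hyp (j : Fin n) : Submodule K (Fin ℓ → K) := LinearMap.ker (pairing K c j)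

/-- The intersection `H_J` of the `H_j`, `j ∈ J`; it is `K ^ ℓ` for `J = ∅`. -/
def hypInter (J : Finset (Fin n)) : Submodule K (Fin ℓ → K) := ⨅ j ∈ J, hyp K c j

/-- `T_j = {π(x) | x ∈ K ^ ℓ, x c_j ∈ R}`. -/
def tor (j : Fin n) : Submodule R (Fin ℓ → FracQuot R K) :=
  ((LinearMap.range (Algebra.linearMap R K)).comap
    ((pairing K c j).restrictScalars R)).map (proj R K ℓ)

/-- The intersection `T_J` of the `T_j`, `j ∈ J`; it is `(K / R) ^ ℓ` for `J = ∅`. -/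
def torInter (J : Finset (Fin n)) : Submodule R (Fin ℓ → FracQuot R K) := ⨅ j ∈ J, tor K c j

/-- The `R`-submodule `π(H_J)` of `(K / R) ^ ℓ`. -/
def projHyp (J : Finset (Fin n)) : Submodule R (Fin ℓ → FracQuot R K) :=
  ((hypInter K c J).restrictScalars R).map (proj R K ℓ)

/-- The coset `z + π(H_J)`. -/
def coset (z : Fin ℓ → FracQuot R K) (J : Finset (Fin n)) : Set (Fin ℓ → FracQuot R K) :=
  (fun v => z + v) '' (projHyp K c J : Set (Fin ℓ → FracQuot R K))

/-- The set of layers `z + π(H_J)` with `J ⊆ [n]` and `z ∈ T_J`. The order dual makes the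
induced order on it the reverse inclusion. -/
def layers : Set (Set (Fin ℓ → FracQuot R K))ᵒᵈ :=
  {Z | ∃ (J : Finset (Fin n)) (z : Fin ℓ → FracQuot R K),
    z ∈ torInter K c J ∧ OrderDual.ofDual Z = coset K c z J}

/-- The `κ`-torsion layers: those of the form `z + π(H_J)` with `z ∈ T_J` whose class in
`T_J / π(H_J)` is killed by every `a ∈ κ`. See `mem_torsionLayers_iff` for the independence
of the choice of `J` and `z`. -/
def torsionLayers (κ : Ideal R) : Set (layers K c) :=
  {Z | ∃ (J : Finset (Fin n)) (z : Fin ℓ → FracQuot R K), z ∈ torInter K c J ∧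
    OrderDual.ofDual (Z : (Set (Fin ℓ → FracQuot R K))ᵒᵈ) = coset K c z J ∧
    ∀ a ∈ κ, a • z ∈ projHyp K c J}

variable {K c} in
theorem mem_coset_iff {z w : Fin ℓ → FracQuot R K} {J : Finset (Fin n)} :
    w ∈ coset K c z J ↔ w - z ∈ projHyp K c J := by
  constructor
  · rintro ⟨v, hv, rfl⟩
    simpa using hv
  · intro h
    exact ⟨w - z, h, by simp⟩

variable {K c} in
theorem coset_eq_imp {z w : Fin ℓ → FracQuot R K} {I J : Finset (Fin n)}
    (h : coset K c z I = coset K c w J) :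
    projHyp K c I = projHyp K c J ∧ z - w ∈ projHyp K c J := by
  have hz : z - w ∈ projHyp K c J := by
    rw [← mem_coset_iff, ← h, mem_coset_iff]
    simp
  refine ⟨?_, hz⟩
  ext v
  have key : z + v ∈ coset K c z I ↔ z + v ∈ coset K c w J := by rw [h]
  rw [mem_coset_iff, mem_coset_iff, add_sub_cancel_left] at key
  rw [key, show z + v - w = v + (z - w) by abel]
  exact Submodule.add_mem_iff_left _ hz

variable {K c} in
/-- Whether a layer `z + π(H_J)` is `κ`-torsion can be read off from any such expression. -/
theorem mem_torsionLayers_iff {κ : Ideal R} (Z : layers K c) {J : Finset (Fin n)}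
    {z : Fin ℓ → FracQuot R K}
    (hZ : OrderDual.ofDual (Z : (Set (Fin ℓ → FracQuot R K))ᵒᵈ) = coset K c z J)
    (hz : z ∈ torInter K c J) :
    Z ∈ torsionLayers K c κ ↔ ∀ a ∈ κ, a • z ∈ projHyp K c J := by
  constructor
  · rintro ⟨I, w, -, hw, h⟩ a ha
    obtain ⟨h1, h2⟩ := coset_eq_imp (hZ.symm.trans hw)
    have h3 := Submodule.add_mem _ (Submodule.smul_mem _ a h2) (h a ha)
    rw [h1]
    simpa [smul_sub] using h3
  · exact fun h => ⟨J, z, hz, hZ, h⟩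

end Base

section Period

variable {R : Type*} [CommRing R] {n ℓ : ℕ} (c : Fin n → Fin ℓ → R)

/-- `φ_J : R ^ ℓ → R ^ J`, `x ↦ x C_J`, where `C_J` is the matrix with columns `c_j`, `j ∈ J`. -/
def phi (J : Finset (Fin n)) : (Fin ℓ → R) →ₗ[R] (J → R) where
  toFun x j := ∑ i, x i * c j i
  map_add' x y := by ext; simp [add_mul, Finset.sum_add_distrib]
  map_smul' a x := by ext; simp [Finset.mul_sum, mul_assoc]

/-- The cokernel of `φ_J`. -/
abbrev coker (J : Finset (Fin n)) : Type _ := (J → R) ⧸ LinearMap.range (phi c J)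

/-- The largest invariant factor of the finitely generated `R`-module `coker φ_J`, i.e. the ideal
`d_r` if `coker φ_J ≃ R/d_1 ⊕ ⋯ ⊕ R/d_r ⊕ (torsion-free)` with nonzero `d_1 ∣ ⋯ ∣ d_r`, and the
unit ideal if `r = 0`; see `topFactor_eq_last` and `topFactor_eq_top`. It is expressed as the
annihilator of the torsion submodule, so that no choice of a decomposition enters. -/
def topFactor (J : Finset (Fin n)) : Ideal R :=
  Module.annihilator R (Submodule.torsion R (coker c J))

/-- The LCM-period: the least common multiple (that is, the intersection) of the largest
invariant factors of `coker φ_J` for `∅ ≠ J ⊆ [n]`. -/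
def lcmPeriod : Ideal R := ⨅ (J : Finset (Fin n)) (_ : J.Nonempty), topFactor c J

theorem mem_topFactor_iff {J : Finset (Fin n)} {T F : Type*} [AddCommGroup T] [Module R T]
    [AddCommGroup F] [Module R F] (hT : Module.IsTorsion R T) (hF : Submodule.torsion R F = ⊥)
    (e : coker c J ≃ₗ[R] T × F) (a : R) :
    a ∈ topFactor c J ↔ ∀ t : T, a • t = 0 := by
  rw [topFactor, Module.mem_annihilator]
  constructor
  · intro h t
    obtain ⟨b, hb⟩ := @hT t
    have ht : e.symm (t, 0) ∈ Submodule.torsion R (coker c J) := by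
      refine (Submodule.mem_torsion_iff _).2 ⟨b, ?_⟩
      change (b : R) • e.symm (t, 0) = 0
      rw [← map_smul, Prod.smul_mk, smul_zero, show (b : R) • t = 0 from hb]
      exact map_zero e.symm
    have h1 : a • e.symm (t, (0 : F)) = 0 := congrArg Subtype.val (h ⟨_, ht⟩)
    rw [← map_smul] at h1
    simpa using congrArg Prod.fst (e.symm.map_eq_zero_iff.1 h1)
  · rintro h ⟨m, hm⟩
    obtain ⟨b, hb⟩ := (Submodule.mem_torsion_iff _).1 hm
    have hb' : (b : R) • m = 0 := hb
    have h2 : (e m).2 ∈ Submodule.torsion R F := by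
      refine (Submodule.mem_torsion_iff _).2 ⟨b, ?_⟩
      change (b : R) • (e m).2 = 0
      rw [← Prod.smul_snd, ← map_smul, hb', map_zero]
      rfl
    rw [hF, Submodule.mem_bot] at h2
    apply Subtype.ext
    change a • m = 0
    apply e.injective
    rw [map_smul, map_zero]
    exact Prod.ext (h _) (by simp [h2])

/-- In every decomposition of `coker φ_J` as in the structure theorem with at least one cyclic
summand, the last of the ideals is `topFactor c J`. -/
theorem topFactor_eq_last [IsDedekindDomain R] {J : Finset (Fin n)} {F : Type*} [AddCommGroup F]
    [Module R F] (hF : Submodule.torsion R F = ⊥) {r : ℕ} (d : Fin (r + 1) → Ideal R)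
    (hd : ∀ i, d i ≠ ⊥) (hdvd : ∀ i j, i ≤ j → d i ∣ d j)
    (e : coker c J ≃ₗ[R] (∀ i, R ⧸ d i) × F) :
    topFactor c J = d (Fin.last r) := by
  have hkill : ∀ a ∈ d (Fin.last r), ∀ t : ∀ i, R ⧸ d i, a • t = 0 := by
    intro a ha t
    funext i
    obtain ⟨y, hy⟩ := Ideal.Quotient.mk_surjective (t i)
    have hi : a * y ∈ d i :=
      Ideal.mul_mem_right _ _ (Ideal.le_of_dvd (hdvd i _ (Fin.le_last i)) ha)
    have h0 : Ideal.Quotient.mk (d i) (a * y) = 0 := Ideal.Quotient.eq_zero_iff_mem.2 hi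
    rw [Pi.smul_apply, ← hy, Pi.zero_apply, Algebra.smul_def, Ideal.Quotient.algebraMap_eq,
      ← map_mul]
    exact h0
  have hT : Module.IsTorsion R (∀ i, R ⧸ d i) := by
    obtain ⟨b, hb, hb0⟩ := Submodule.exists_mem_ne_zero_of_ne_bot (hd (Fin.last r))
    intro t
    exact ⟨⟨b, mem_nonZeroDivisors_of_ne_zero hb0⟩, hkill b hb t⟩
  ext a
  rw [mem_topFactor_iff c hT hF e]
  refine ⟨fun h => ?_, hkill a⟩
  have h1 := congrFun (h 1) (Fin.last r)
  rw [Pi.smul_apply, Pi.one_apply, Pi.zero_apply, Algebra.smul_def, mul_one,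
    Ideal.Quotient.algebraMap_eq] at h1
  exact Ideal.Quotient.eq_zero_iff_mem.1 h1

/-- If `coker φ_J` is torsion-free (no cyclic summands), then `topFactor c J` is the unit ideal. -/
theorem topFactor_eq_top {J : Finset (Fin n)} (h : Submodule.torsion R (coker c J) = ⊥) :
    topFactor c J = ⊤ := by
  rw [topFactor, h, Module.annihilator_eq_top_iff]
  infer_instance

end Period

section Localization

variable (R RS K : Type*) [CommRing R] [CommRing RS] [Field K] [Algebra R RS] [Algebra R K]
  [Algebra RS K] [IsScalarTower R RS K]

/-- The canonical map `K / R → K / R_S`. -/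
def etaOne : FracQuot R K →ₗ[R] FracQuot RS K :=
  Submodule.liftQ _ ((Submodule.mkQ (LinearMap.range (Algebra.linearMap RS K))).restrictScalars R)
    (by
      rintro _ ⟨a, rfl⟩
      rw [LinearMap.mem_ker]
      refine (Submodule.Quotient.mk_eq_zero _).2 ⟨algebraMap R RS a, ?_⟩
      simp [← IsScalarTower.algebraMap_apply])

/-- The canonical map `η_S : (K / R) ^ ℓ → (K / R_S) ^ ℓ`. -/
def eta (ℓ : ℕ) : (Fin ℓ → FracQuot R K) →ₗ[R] (Fin ℓ → FracQuot RS K) :=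
  (etaOne R RS K).compLeft (Fin ℓ)

variable {R K} {n ℓ : ℕ}

/-- The family `c` regarded as a family of vectors of `R_S ^ ℓ`. -/
def baseChange (c : Fin n → Fin ℓ → R) : Fin n → Fin ℓ → RS := fun j i => algebraMap R RS (c j i)

theorem eta_proj (x : Fin ℓ → K) : eta R RS K ℓ (proj R K ℓ x) = proj RS K ℓ x := rfl

theorem pairing_baseChange (c : Fin n → Fin ℓ → R) (j : Fin n) :
    pairing K (baseChange RS c) j = pairing K c j := by
  ext x
  simp [pairing, baseChange, ← IsScalarTower.algebraMap_apply]

theorem hypInter_baseChange (c : Fin n → Fin ℓ → R) (J : Finset (Fin n)) :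
    hypInter K (baseChange RS c) J = hypInter K c J := by
  simp only [hypInter, hyp, pairing_baseChange]

theorem eta_mem_torInter (c : Fin n → Fin ℓ → R) {J : Finset (Fin n)}
    {z : Fin ℓ → FracQuot R K} (hz : z ∈ torInter K c J) :
    eta R RS K ℓ z ∈ torInter K (baseChange RS c) J := by
  simp only [torInter, Submodule.mem_iInf] at hz ⊢
  intro j hj
  obtain ⟨x, ⟨a, ha⟩, rfl⟩ := hz j hj
  refine ⟨x, ⟨algebraMap R RS a, ?_⟩, (eta_proj RS x).symm⟩
  simp only [LinearMap.restrictScalars_apply, Algebra.linearMap_apply] at ha ⊢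
  rw [pairing_baseChange, ← ha, ← IsScalarTower.algebraMap_apply]

theorem eta_image_coset (c : Fin n → Fin ℓ → R) (z : Fin ℓ → FracQuot R K)
    (J : Finset (Fin n)) :
    eta R RS K ℓ '' coset K c z J = coset K (baseChange RS c) (eta R RS K ℓ z) J := by
  ext w
  constructor
  · rintro ⟨_, ⟨_, ⟨x, hx, rfl⟩, rfl⟩, rfl⟩
    refine ⟨proj RS K ℓ x, ⟨x, ?_, rfl⟩, ?_⟩
    · simpa [hypInter_baseChange] using hx
    · simp [eta_proj]
  · rintro ⟨_, ⟨x, hx, rfl⟩, rfl⟩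
    refine ⟨z + proj R K ℓ x, ⟨proj R K ℓ x, ⟨x, ?_, rfl⟩, rfl⟩, ?_⟩
    · simpa [hypInter_baseChange] using hx
    · simp [eta_proj]

/-- The order-preserving map `Z ↦ η_S(Z) = {η_S(z) | z ∈ Z}` between the posets of layers. -/
def layerMap (c : Fin n → Fin ℓ → R) : layers K c →o layers K (baseChange RS c) where
  toFun Z := ⟨OrderDual.toDual
      (eta R RS K ℓ '' OrderDual.ofDual (Z : (Set (Fin ℓ → FracQuot R K))ᵒᵈ)), by
    obtain ⟨Z, J, z, hz, hZ⟩ := Z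
    exact ⟨J, eta R RS K ℓ z, eta_mem_torInter RS c hz, by
      simp only [OrderDual.ofDual_toDual, hZ, eta_image_coset]⟩⟩
  monotone' Z W h := Set.image_mono (f := eta R RS K ℓ)
    (show OrderDual.ofDual (W : (Set (Fin ℓ → FracQuot R K))ᵒᵈ) ⊆
      OrderDual.ofDual (Z : (Set (Fin ℓ → FracQuot R K))ᵒᵈ) from h)

end Localization

end TorsionArrangement

/-! Put `κ = δ ∩ R` for a nonzero ideal `δ` of `R_S`; divisibility of the nonzero period enters only
to make `δ` nonzero. As `κ` is contracted from `R_S`, each `s ∈ S` acts injectively on `R/κ`; this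
ring is finite, so `s` is invertible modulo `κ`. Membership in `π(H_J)` or `T_J` over `R_S` descends
to `R` after multiplication by some `s ∈ S`, and on `κ`-torsion classes `s` can be undone by `b`
with `bs - 1 ∈ κ`. This yields order reflection (`le_of_layerMap_le`) and surjectivity
(`exists_layerMap_eq`). That `R_S` is not a field lets `H_J` be compared through `π(H_J)`. The final
claim is the case `δ = ρ R_S`, with `ρ` the period over `R`: this ideal already kills every `T_J /
π(H_J)` over `R_S`, so the periods over `R` and `R_S` need not be compared. -/

namespace TorsionArrangement

/-! ### Lifts to `K ^ ℓ`, inclusions of layers, finiteness -/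

section Base

variable {R K : Type*} [CommRing R] [Field K] [Algebra R K] {n ℓ : ℕ} (c : Fin n → Fin ℓ → R)

theorem proj_surjective : Function.Surjective (proj R K ℓ) := fun z => by
  choose x hx using fun i => Submodule.mkQ_surjective (LinearMap.range (Algebra.linearMap R K)) (z i)
  exact ⟨x, funext hx⟩

theorem proj_eq_zero_iff {x : Fin ℓ → K} :
    proj R K ℓ x = 0 ↔ ∃ r : Fin ℓ → R, x = fun i => algebraMap R K (r i) := by
  constructor
  · intro h
    have h' : ∀ i, ∃ a, algebraMap R K a = x i := fun i =>
      (Submodule.Quotient.mk_eq_zero _).1 (congrFun h i)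
    choose r hr using h'
    exact ⟨r, funext fun i => (hr i).symm⟩
  · rintro ⟨r, rfl⟩
    funext i
    exact (Submodule.Quotient.mk_eq_zero _).2 ⟨r i, rfl⟩

theorem mem_hypInter_iff {J : Finset (Fin n)} {x : Fin ℓ → K} :
    x ∈ hypInter K c J ↔ ∀ j ∈ J, pairing K c j x = 0 := by
  simp [hypInter, hyp, Submodule.mem_iInf]

theorem pairing_algebraMap (r : Fin ℓ → R) (j : Fin n) :
    pairing K c j (fun i => algebraMap R K (r i)) = algebraMap R K (∑ i, r i * c j i) := by
  simp [pairing]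

theorem pairing_smul (a : R) (x : Fin ℓ → K) (j : Fin n) :
    pairing K c j (a • x) = algebraMap R K a * pairing K c j x := by
  rw [← algebraMap_smul K a x, map_smul, smul_eq_mul]

/-- `π(x) ∈ π(H_J)` if and only if `x` has the same pairings with the `c_j`, `j ∈ J`, as some
integral vector. -/
theorem proj_mem_projHyp_iff {J : Finset (Fin n)} {x : Fin ℓ → K} :
    proj R K ℓ x ∈ projHyp K c J ↔
      ∃ r : Fin ℓ → R, ∀ j ∈ J, pairing K c j x = pairing K c j (fun i => algebraMap R K (r i)) := by
  constructor
  · rintro ⟨y, hy, hxy⟩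
    obtain ⟨r, hr⟩ := proj_eq_zero_iff.1 (show proj R K ℓ (x - y) = 0 by simp [hxy])
    refine ⟨r, fun j hj => ?_⟩
    have h0 := (mem_hypInter_iff c).1 hy j hj
    rw [← hr, map_sub, h0, sub_zero]
  · rintro ⟨r, hr⟩
    refine ⟨x - fun i => algebraMap R K (r i), (mem_hypInter_iff c).2 fun j hj => ?_, ?_⟩
    · rw [map_sub, hr j hj, sub_self]
    · rw [map_sub, proj_eq_zero_iff.2 ⟨r, rfl⟩, sub_zero]

/-- Two lifts differ by an integral vector, whose pairings lie in `R`; hence one lift tests all `j ∈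
J` at once. -/
theorem proj_mem_torInter_iff {J : Finset (Fin n)} {x : Fin ℓ → K} :
    proj R K ℓ x ∈ torInter K c J ↔ ∀ j ∈ J, ∃ a : R, algebraMap R K a = pairing K c j x := by
  simp only [torInter, Submodule.mem_iInf]
  refine forall₂_congr fun j _ => ⟨?_, fun ⟨a, ha⟩ => ⟨x, ⟨a, ha⟩, rfl⟩⟩
  rintro ⟨y, ⟨a, ha⟩, hxy⟩
  obtain ⟨r, hr⟩ := proj_eq_zero_iff.1 (show proj R K ℓ (x - y) = 0 by simp [hxy])
  refine ⟨∑ i, r i * c j i + a, ?_⟩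
  have ha' : algebraMap R K a = pairing K c j y := ha
  rw [map_add, ha', ← pairing_algebraMap, ← hr, map_sub, sub_add_cancel]

variable {c} in
theorem coset_subset_coset_iff {z w : Fin ℓ → FracQuot R K} {I J : Finset (Fin n)} :
    coset K c z I ⊆ coset K c w J ↔
      projHyp K c I ≤ projHyp K c J ∧ z - w ∈ projHyp K c J := by
  constructor
  · intro h
    have hz : z - w ∈ projHyp K c J := mem_coset_iff.1 (h (mem_coset_iff.2 (by simp)))
    refine ⟨fun v hv => ?_, hz⟩
    have h1 := mem_coset_iff.1 (h (show z + v ∈ _ from mem_coset_iff.2 (by simpa using hv)))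
    rw [show z + v - w = v + (z - w) by abel] at h1
    exact (Submodule.add_mem_iff_left _ hz).1 h1
  · rintro ⟨h1, h2⟩ v hv
    rw [mem_coset_iff] at hv ⊢
    simpa using add_mem (h1 hv) h2

/-- Passing from `H_J` to `π(H_J)` loses no inclusions unless `R = K`. -/
theorem hypInter_le_of_projHyp_le [IsDomain R] [IsFractionRing R K] (hR : ¬ IsField R)
    {I J : Finset (Fin n)} (h : projHyp K c I ≤ projHyp K c J) :
    hypInter K c I ≤ hypInter K c J := by
  intro x hx
  rw [mem_hypInter_iff]
  intro j hj
  by_contra h0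
  refine hR (MulEquiv.isField (Field.toIsField K)
    (RingEquiv.ofBijective (algebraMap R K) ⟨IsFractionRing.injective R K, fun t => ?_⟩).toMulEquiv)
  -- Rescaling inside `H_I` gives the pairing with `c_j` an arbitrary value `t`, which is then
  -- forced into `R`.
  have hy : (t / pairing K c j x) • x ∈ hypInter K c I := Submodule.smul_mem _ _ hx
  obtain ⟨r, hr⟩ := (proj_mem_projHyp_iff c).1 (h ⟨_, hy, rfl⟩)
  refine ⟨_, (pairing_algebraMap c r j).symm.trans ?_⟩
  rw [← hr j hj, map_smul, smul_eq_mul, div_mul_cancel₀ _ h0]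

/-- For a nonzero `a ∈ κ`, a `κ`-torsion layer is the class of `r / a` modulo `π(H_J)` with `r`
integral, and depends only on `J` and on `r` modulo `a`. -/
theorem finite_torsionLayers [IsDomain R] [IsFractionRing R K] [Ring.HasFiniteQuotients R]
    {κ : Ideal R} (hκ : κ ≠ ⊥) : Finite (torsionLayers K c κ) := by
  obtain ⟨a, ha, ha0⟩ := Submodule.exists_mem_ne_zero_of_ne_bot hκ
  have : Finite (R ⧸ Ideal.span {a}) :=
    Ring.HasFiniteQuotients.finiteQuotient (by simpa using ha0)
  have haK : algebraMap R K a ≠ 0 := by simpa using ha0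
  let f : Finset (Fin n) × (Fin ℓ → R ⧸ Ideal.span {a}) → (Set (Fin ℓ → FracQuot R K))ᵒᵈ := fun p =>
    OrderDual.toDual (coset K c
      (proj R K ℓ fun i => (algebraMap R K a)⁻¹ * algebraMap R K (p.2 i).out) p.1)
  have hf : ∀ Z : torsionLayers K c κ, ((Z : layers K c) : (Set (Fin ℓ → FracQuot R K))ᵒᵈ) ∈ Set.range f := by
    rintro ⟨⟨Z, hZ⟩, J, z, -, hz, h⟩
    obtain ⟨x, rfl⟩ := proj_surjective z
    have h1 := h a ha
    rw [← map_smul, proj_mem_projHyp_iff] at h1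
    obtain ⟨r, hr⟩ := h1
    refine ⟨(J, fun i => Ideal.Quotient.mk _ (r i)), ?_⟩
    have hu : ∀ i, ∃ u, (Quotient.out (Ideal.Quotient.mk (Ideal.span {a}) (r i))) - r i = a * u := by
      intro i
      rw [← dvd_def, ← Ideal.mem_span_singleton, ← Ideal.Quotient.eq]
      exact Quotient.out_eq _
    choose u hu using hu
    refine OrderDual.ofDual.injective (Eq.trans ?_ hz.symm)
    have key : proj R K ℓ (fun i => (algebraMap R K a)⁻¹ * algebraMap R K
        (Quotient.out (Ideal.Quotient.mk (Ideal.span {a}) (r i)))) - proj R K ℓ x ∈ projHyp K c J := by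
      rw [← map_sub, proj_mem_projHyp_iff]
      refine ⟨u, fun j hj => ?_⟩
      have h2 := hr j hj
      rw [pairing_smul] at h2
      have h3 : (fun i => (algebraMap R K a)⁻¹ * algebraMap R K
          (Quotient.out (Ideal.Quotient.mk (Ideal.span {a}) (r i)))) =
          (algebraMap R K a)⁻¹ • (fun i => algebraMap R K (r i)) + fun i => algebraMap R K (u i) := by
        funext i
        rw [sub_eq_iff_eq_add.1 (hu i)]
        simp only [map_add, map_mul, Pi.add_apply, Pi.smul_apply, smul_eq_mul]
        field_simp
        ring
      rw [h3, map_sub, map_add, map_smul, ← h2, smul_eq_mul, inv_mul_cancel_left₀ haK]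
      ring
    exact (coset_subset_coset_iff.2 ⟨le_rfl, key⟩).antisymm
      (coset_subset_coset_iff.2 ⟨le_rfl, by simpa using neg_mem key⟩)
  choose g hg using hf
  refine Finite.of_injective g fun Z W h => ?_
  apply Subtype.ext
  apply Subtype.ext
  rw [← hg, h, hg]

end Base

/-! ### Nonvanishing of the period and its action on `T_J / π(H_J)` -/

section Period

variable {R : Type*} [CommRing R] [IsDomain R] [IsNoetherianRing R] {n ℓ : ℕ}
  (c : Fin n → Fin ℓ → R)

/-- The torsion submodule is finitely generated, so a single nonzero element kills it. -/
theorem topFactor_ne_bot (J : Finset (Fin n)) : topFactor c J ≠ ⊥ := by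
  have hT : Module.IsTorsion R (Submodule.torsion R (coker c J)) := Submodule.torsion_isTorsion
  obtain ⟨a, ha, ha0⟩ := Submodule.annihilator_top_inter_nonZeroDivisors hT
  rw [Submodule.annihilator_top] at ha
  exact (Submodule.ne_bot_iff _).2 ⟨a, ha, nonZeroDivisors.ne_zero ha0⟩

theorem lcmPeriod_ne_bot : lcmPeriod c ≠ ⊥ := by
  intro h
  -- Including `J = ∅` only shrinks the intersection; a finite intersection inside the prime `⊥` has
  -- a factor inside it.
  have h1 : Finset.univ.inf (topFactor c) ≤ (⊥ : Ideal R) := by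
    rw [← h, lcmPeriod]
    exact le_iInf₂ fun J _ => Finset.inf_le (Finset.mem_univ J)
  obtain ⟨J, -, hJ⟩ := (Ideal.IsPrime.inf_le' Ideal.isPrime_bot).1 h1
  exact topFactor_ne_bot c J (le_bot_iff.1 hJ)

omit [IsDomain R] [IsNoetherianRing R] in
/-- The largest invariant factor of `coker φ_J` kills `T_J / π(H_J)`. -/
theorem smul_proj_mem_projHyp_of_mem_topFactor {K : Type*} [Field K] [Algebra R K]
    [IsFractionRing R K] {J : Finset (Fin n)} {x : Fin ℓ → K}
    (hx : proj R K ℓ x ∈ torInter K c J) {d : R} (hd : d ∈ topFactor c J) :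
    d • proj R K ℓ x ∈ projHyp K c J := by
  have hx' : ∀ j : J, ∃ a : R, algebraMap R K a = pairing K c j x := fun j =>
    (proj_mem_torInter_iff c).1 hx j j.2
  choose v hv using hx'
  -- Clearing the denominators of `x` shows that the vector `v` of its pairings is torsion in `coker
  -- φ_J`.
  obtain ⟨b, hb⟩ := IsLocalization.exist_integer_multiples_of_finite (nonZeroDivisors R) x
  choose y hy using hb
  have hbv : (b : R) • v = phi c J y := by
    funext j
    apply IsFractionRing.injective R K
    have h1 : (fun i => algebraMap R K (y i)) = (b : R) • x := funext hy
    change algebraMap R K (b * v j) = algebraMap R K (∑ i, y i * c j i)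
    rw [← pairing_algebraMap, h1, pairing_smul, map_mul, hv]
  have ht : (Submodule.Quotient.mk v : coker c J) ∈ Submodule.torsion R (coker c J) := by
    refine (Submodule.mem_torsion_iff _).2 ⟨b, ?_⟩
    change (b : R) • (Submodule.Quotient.mk v : coker c J) = 0
    rw [← Submodule.Quotient.mk_smul, Submodule.Quotient.mk_eq_zero, hbv]
    exact ⟨y, rfl⟩
  have h2 : d • (Submodule.Quotient.mk v : coker c J) = 0 :=
    congrArg Subtype.val (Module.mem_annihilator.1 hd ⟨_, ht⟩)
  rw [← Submodule.Quotient.mk_smul, Submodule.Quotient.mk_eq_zero] at h2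
  obtain ⟨r, hr⟩ := h2
  rw [← map_smul, proj_mem_projHyp_iff]
  refine ⟨r, fun j hj => ?_⟩
  have h3 : ∑ i, r i * c j i = d * v ⟨j, hj⟩ := congrFun hr ⟨j, hj⟩
  rw [pairing_algebraMap, h3, pairing_smul, map_mul, hv]

end Period

/-! ### Descent from `R_S` to `R` -/

section Localization

variable {R RS K : Type*} [CommRing R] [CommRing RS] [Field K] [Algebra R RS] [Algebra R K]
  [Algebra RS K] [IsScalarTower R RS K] {n ℓ : ℕ} (c : Fin n → Fin ℓ → R)

theorem eta_mem_projHyp {J : Finset (Fin n)} {w : Fin ℓ → FracQuot R K}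
    (hw : w ∈ projHyp K c J) : eta R RS K ℓ w ∈ projHyp K (baseChange RS c) J := by
  obtain ⟨x, hx, rfl⟩ := hw
  exact ⟨x, by simpa [hypInter_baseChange] using hx, rfl⟩

theorem algebraMap_smul_proj (a : R) (x : Fin ℓ → K) :
    algebraMap R RS a • proj RS K ℓ x = eta R RS K ℓ (a • proj R K ℓ x) := by
  rw [← map_smul, ← map_smul, eta_proj, algebraMap_smul]

variable (S : Submonoid R) [IsLocalization S RS]

/-- The `R_S`-integral vector witnessing membership has a common denominator in `S`. -/
theorem exists_smul_mem_projHyp_of_eta_mem {J : Finset (Fin n)} {w : Fin ℓ → FracQuot R K}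
    (hw : eta R RS K ℓ w ∈ projHyp K (baseChange RS c) J) :
    ∃ s ∈ S, s • w ∈ projHyp K c J := by
  obtain ⟨x, rfl⟩ := proj_surjective w
  rw [eta_proj, proj_mem_projHyp_iff] at hw
  obtain ⟨r, hr⟩ := hw
  obtain ⟨s, hs⟩ := IsLocalization.exist_integer_multiples_of_finite S r
  choose y hy using hs
  refine ⟨s, s.2, ?_⟩
  rw [← map_smul, proj_mem_projHyp_iff]
  refine ⟨y, fun j hj => ?_⟩
  have h1 : (fun i => algebraMap R K (y i)) = (s : R) • fun i => algebraMap RS K (r i) := by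
    funext i
    rw [IsScalarTower.algebraMap_apply R RS K, hy, Algebra.smul_def, map_mul,
      ← IsScalarTower.algebraMap_apply, Pi.smul_apply, Algebra.smul_def]
  have h2 := hr j hj
  rw [pairing_baseChange] at h2
  rw [h1, pairing_smul, pairing_smul, h2]

theorem exists_smul_mem_torInter_of_eta_mem {J : Finset (Fin n)} {w : Fin ℓ → FracQuot R K}
    (hw : eta R RS K ℓ w ∈ torInter K (baseChange RS c) J) :
    ∃ s ∈ S, s • w ∈ torInter K c J := by
  obtain ⟨x, rfl⟩ := proj_surjective w
  have hw' : ∀ j : J, ∃ a : RS, algebraMap RS K a = pairing K c j x := fun j => by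
    rw [← pairing_baseChange RS]
    exact (proj_mem_torInter_iff _).1 hw j j.2
  choose v hv using hw'
  obtain ⟨s, hs⟩ := IsLocalization.exist_integer_multiples_of_finite S v
  choose y hy using hs
  refine ⟨s, s.2, ?_⟩
  rw [← map_smul, proj_mem_torInter_iff]
  intro j hj
  refine ⟨y ⟨j, hj⟩, ?_⟩
  rw [pairing_smul, ← hv ⟨j, hj⟩, IsScalarTower.algebraMap_apply R RS K (y _), hy,
    Algebra.smul_def, map_mul, ← IsScalarTower.algebraMap_apply]

include S in
theorem comap_ne_bot {δ : Ideal RS} (hδ : δ ≠ ⊥) : δ.comap (algebraMap R RS) ≠ ⊥ := fun h =>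
  hδ (by rw [← IsLocalization.map_under S RS δ, Ideal.under_def, h, Ideal.map_bot])

variable {S} in
/-- The elements of `S` are units modulo the contraction of a nonzero ideal of `R_S`. -/
theorem exists_mul_sub_one_mem_comap [IsDomain R] [Ring.HasFiniteQuotients R] {δ : Ideal RS}
    (hδ : δ ≠ ⊥) {s : R} (hs : s ∈ S) : ∃ b, b * s - 1 ∈ δ.comap (algebraMap R RS) := by
  set κ := δ.comap (algebraMap R RS) with hκ
  have : Finite (R ⧸ κ) := Ring.HasFiniteQuotients.finiteQuotient (comap_ne_bot S hδ)
  -- `s` is a unit in `R_S`, so `ts ∈ κ` forces `t ∈ κ`; finiteness then makes multiplication by `s`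
  -- surjective.
  have hinj : Function.Injective fun t : R ⧸ κ => t * Ideal.Quotient.mk κ s := by
    intro t u htu
    obtain ⟨t, rfl⟩ := Ideal.Quotient.mk_surjective t
    obtain ⟨u, rfl⟩ := Ideal.Quotient.mk_surjective u
    simp only [← map_mul, Ideal.Quotient.eq, ← sub_mul] at htu ⊢
    rw [hκ, Ideal.mem_comap, map_mul] at htu
    exact (Ideal.mul_unit_mem_iff_mem _ (IsLocalization.map_units RS ⟨s, hs⟩)).1 htu
  obtain ⟨b, hb⟩ := Finite.surjective_of_injective hinj 1
  obtain ⟨b, rfl⟩ := Ideal.Quotient.mk_surjective b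
  refine ⟨b, Ideal.Quotient.eq.1 ?_⟩
  simpa using hb

include S in
theorem layerMap_mem_torsionLayers {δ : Ideal RS} {Z : layers K c}
    (hZ : Z ∈ torsionLayers K c (δ.comap (algebraMap R RS))) :
    layerMap RS c Z ∈ torsionLayers K (baseChange RS c) δ := by
  obtain ⟨J, z, hz, hZ, h⟩ := hZ
  refine ⟨J, eta R RS K ℓ z, eta_mem_torInter RS c hz, ?_, ?_⟩
  · change eta R RS K ℓ '' OrderDual.ofDual (Z : (Set (Fin ℓ → FracQuot R K))ᵒᵈ) = _
    rw [hZ, eta_image_coset]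
  · obtain ⟨x, rfl⟩ := proj_surjective z
    rw [eta_proj]
    intro a ha
    -- The scalars carrying `π(x)` into `π(H_J)` form an ideal, and `δ` is generated by the image of
    -- its contraction.
    have hle : δ ≤ (projHyp K (baseChange RS c) J).comap
        (LinearMap.toSpanSingleton RS _ (proj RS K ℓ x)) := by
      rw [← IsLocalization.map_under S RS δ, Ideal.map_le_iff_le_comap]
      intro b hb
      change algebraMap R RS b • proj RS K ℓ x ∈ projHyp K (baseChange RS c) J
      rw [algebraMap_smul_proj]
      exact eta_mem_projHyp c (h b hb)
    exact hle ha

/-- Each generator of `κ` needs its own denominator; the product of these finitely many serves all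
of `κ`. -/
theorem exists_smul_mem_projHyp_of_fg {κ : Ideal R} (hκ : κ.FG) {J : Finset (Fin n)}
    {w : Fin ℓ → FracQuot R K}
    (h : ∀ a ∈ κ, eta R RS K ℓ (a • w) ∈ projHyp K (baseChange RS c) J) :
    ∃ s ∈ S, ∀ a ∈ κ, a • s • w ∈ projHyp K c J := by
  obtain ⟨T, rfl⟩ := hκ
  choose s hs hs' using fun a : T =>
    exists_smul_mem_projHyp_of_eta_mem c S (h a (Submodule.subset_span a.2))
  refine ⟨∏ a, s a, prod_mem fun a _ => hs a, fun a ha => ?_⟩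
  have hle : Ideal.span T ≤ (projHyp K c J).comap
      (LinearMap.toSpanSingleton R _ ((∏ a, s a) • w)) := by
    rw [Ideal.span_le]
    intro a ha
    obtain ⟨t, ht⟩ := Finset.dvd_prod_of_mem s (Finset.mem_univ ⟨a, ha⟩)
    change a • (∏ a, s a) • w ∈ projHyp K c J
    have h1 := Submodule.smul_mem _ t (hs' ⟨a, ha⟩)
    rw [ht]
    convert h1 using 1
    simp only [smul_smul]
    congr 1
    ring
  exact hle ha

variable [IsDomain R] [Ring.HasFiniteQuotients R]

include S in
theorem le_of_layerMap_le [IsDomain RS] [IsFractionRing RS K] (hRS : ¬ IsField RS) {δ : Ideal RS}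
    (hδ : δ ≠ ⊥) {Z W : layers K c} (hZ : Z ∈ torsionLayers K c (δ.comap (algebraMap R RS)))
    (hW : W ∈ torsionLayers K c (δ.comap (algebraMap R RS)))
    (h : layerMap RS c Z ≤ layerMap RS c W) : Z ≤ W := by
  obtain ⟨I, z, -, hZ, hz⟩ := hZ
  obtain ⟨J, w, -, hW, hw⟩ := hW
  change eta R RS K ℓ '' OrderDual.ofDual (W : (Set (Fin ℓ → FracQuot R K))ᵒᵈ) ⊆
    eta R RS K ℓ '' OrderDual.ofDual (Z : (Set (Fin ℓ → FracQuot R K))ᵒᵈ) at h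
  change OrderDual.ofDual (W : (Set (Fin ℓ → FracQuot R K))ᵒᵈ) ⊆
    OrderDual.ofDual (Z : (Set (Fin ℓ → FracQuot R K))ᵒᵈ)
  rw [hZ, hW, eta_image_coset, eta_image_coset, coset_subset_coset_iff, ← map_sub] at h
  rw [hZ, hW, coset_subset_coset_iff]
  have hle : projHyp K c J ≤ projHyp K c I := by
    have h1 := hypInter_le_of_projHyp_le _ hRS h.1
    rw [hypInter_baseChange, hypInter_baseChange] at h1
    exact Submodule.map_mono h1
  refine ⟨hle, ?_⟩
  obtain ⟨s, hs, hs'⟩ := exists_smul_mem_projHyp_of_eta_mem c S h.2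
  obtain ⟨b, hb⟩ := exists_mul_sub_one_mem_comap hδ hs
  -- Both layers are `κ`-torsion modulo `π(H_I)`; subtracting this from `bs(w - z)` leaves `w - z`.
  have h2 : (b * s - 1) • (w - z) ∈ projHyp K c I := by
    rw [smul_sub]
    exact sub_mem (hle (hw _ hb)) (hz _ hb)
  have h3 := sub_mem (Submodule.smul_mem _ b hs') h2
  rwa [smul_smul, sub_smul, one_smul, sub_sub_cancel] at h3

include S in
theorem exists_layerMap_eq {δ : Ideal RS} (hδ : δ ≠ ⊥) {Z : layers K (baseChange RS c)}
    (hZ : Z ∈ torsionLayers K (baseChange RS c) δ) :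
    ∃ W ∈ torsionLayers K c (δ.comap (algebraMap R RS)), layerMap RS c W = Z := by
  obtain ⟨J, z, hz, hZ, h⟩ := hZ
  obtain ⟨x, rfl⟩ := proj_surjective z
  have hκ : ∀ a ∈ δ.comap (algebraMap R RS),
      eta R RS K ℓ (a • proj R K ℓ x) ∈ projHyp K (baseChange RS c) J := fun a ha => by
    rw [← algebraMap_smul_proj]
    exact h _ ha
  obtain ⟨s, hs, hs'⟩ := exists_smul_mem_projHyp_of_fg c S (IsNoetherian.noetherian _) hκ
  obtain ⟨t, ht, ht'⟩ := exists_smul_mem_torInter_of_eta_mem c S (w := proj R K ℓ x) hz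
  -- `s` secures `κ`-torsion and `t` membership in `T_J`; `b` inverts `st` modulo `κ`, so that
  -- `b(st)x` still maps to the given layer.
  obtain ⟨b, hb⟩ := exists_mul_sub_one_mem_comap hδ (mul_mem hs ht)
  have hmem : proj R K ℓ ((b * (s * t)) • x) ∈ torInter K c J := by
    convert Submodule.smul_mem _ (b * s) ht' using 1
    rw [map_smul, smul_smul, mul_assoc]
  have htors : ∀ a ∈ δ.comap (algebraMap R RS),
      a • proj R K ℓ ((b * (s * t)) • x) ∈ projHyp K c J := fun a ha => by
    convert Submodule.smul_mem _ (b * t) (hs' a ha) using 1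
    rw [map_smul]
    simp only [smul_smul]
    congr 1
    ring
  refine ⟨⟨OrderDual.toDual (coset K c (proj R K ℓ ((b * (s * t)) • x)) J), J, _, hmem, rfl⟩,
    ⟨J, _, hmem, rfl, htors⟩, ?_⟩
  apply Subtype.ext
  apply OrderDual.ofDual.injective
  change eta R RS K ℓ '' coset K c (proj R K ℓ ((b * (s * t)) • x)) J = _
  rw [hZ, eta_image_coset]
  have key : eta R RS K ℓ (proj R K ℓ ((b * (s * t)) • x)) - proj RS K ℓ x ∈
      projHyp K (baseChange RS c) J := by
    have h1 := hκ _ hb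
    rwa [← map_smul, sub_smul, one_smul, map_sub, map_sub, eta_proj RS x] at h1
  exact (coset_subset_coset_iff.2 ⟨le_rfl, key⟩).antisymm
    (coset_subset_coset_iff.2 ⟨le_rfl, by simpa using neg_mem key⟩)

include S in
/-- For every nonzero ideal `δ` of `R_S`, the map `Z ↦ η_S(Z)` restricts to an isomorphism from
the `δ ∩ R`-torsion layers onto the `δ`-torsion layers. -/
theorem exists_orderIso_torsionLayers [IsDomain RS] [IsFractionRing RS K] (hRS : ¬ IsField RS)
    {δ : Ideal RS} (hδ : δ ≠ ⊥) :
    ∃ e : torsionLayers K c (δ.comap (algebraMap R RS)) ≃o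
        torsionLayers K (baseChange RS c) δ,
      ∀ Z, (e Z : layers K (baseChange RS c)) = layerMap RS c Z := by
  let f : torsionLayers K c (δ.comap (algebraMap R RS)) ↪o torsionLayers K (baseChange RS c) δ :=
    OrderEmbedding.ofMapLEIff
      (fun Z => ⟨layerMap RS c Z, layerMap_mem_torsionLayers c S Z.2⟩)
      (fun Z W => ⟨le_of_layerMap_le c S hRS hδ Z.2 W.2, fun h => (layerMap RS c).monotone h⟩)
  refine ⟨RelIso.ofSurjective f fun Z => ?_, fun Z => rfl⟩
  obtain ⟨W, hW, h⟩ := exists_layerMap_eq c S hδ Z.2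
  exact ⟨⟨W, hW⟩, Subtype.ext h⟩

omit [IsDomain R] [Ring.HasFiniteQuotients R] in
include S in
/-- The extension to `R_S` of the LCM-period over `R` kills all layers over `R_S`. -/
theorem torsionLayers_map_lcmPeriod [IsFractionRing R K] :
    torsionLayers K (baseChange RS c) ((lcmPeriod c).map (algebraMap R RS)) = Set.univ := by
  refine Set.eq_univ_of_forall ?_
  rintro ⟨Z, J, z, hz, hZ⟩
  refine ⟨J, z, hz, hZ, fun a ha => ?_⟩
  obtain ⟨x, rfl⟩ := proj_surjective z
  have hle : (lcmPeriod c).map (algebraMap R RS) ≤ (projHyp K (baseChange RS c) J).comap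
      (LinearMap.toSpanSingleton RS _ (proj RS K ℓ x)) := by
    rw [Ideal.map_le_iff_le_comap]
    intro d hd
    change algebraMap R RS d • proj RS K ℓ x ∈ projHyp K (baseChange RS c) J
    -- The period ignores `J = ∅`, where `π(H_J)` is everything.
    rcases J.eq_empty_or_nonempty with rfl | hJ
    · rw [← map_smul, proj_mem_projHyp_iff]
      exact ⟨0, by simp⟩
    obtain ⟨t, ht, ht'⟩ := exists_smul_mem_torInter_of_eta_mem c S (w := proj R K ℓ x) hz
    rw [← map_smul] at ht'
    have hd' : d ∈ topFactor c J := iInf₂_le (f := fun J _ => topFactor c J) J hJ hd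
    have h1 := eta_mem_projHyp (RS := RS) c (smul_proj_mem_projHyp_of_mem_topFactor c ht' hd')
    rw [← algebraMap_smul_proj, ← algebraMap_smul RS t x, map_smul, smul_comm] at h1
    -- Over `R` only `tx` is known to lie in `T_J`; over `R_S` the unit `t` cancels.
    exact (Submodule.smul_mem_iff_of_isUnit _ (IsLocalization.map_units RS ⟨t, ht⟩)).1 h1
  exact hle ha

end Localization

end TorsionArrangement

theorem mainTheorem6 {R RS K : Type*} [CommRing R] [IsDedekindDomain R]
    [Ring.HasFiniteQuotients R] [Field K] [Algebra R K] [IsFractionRing R K]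
    (S : Submonoid R) (hS : (0 : R) ∉ S)
    [CommRing RS] [Algebra R RS] [IsLocalization S RS] (hRS : ¬ IsField RS)
    [Algebra RS K] [IsScalarTower R RS K]
    {n ℓ : ℕ} (c : Fin n → Fin ℓ → R) :
    (∀ δ : Ideal RS, δ ∣ TorsionArrangement.lcmPeriod (TorsionArrangement.baseChange RS c) →
      Finite (TorsionArrangement.torsionLayers K c (δ.comap (algebraMap R RS))) ∧
      Finite (TorsionArrangement.torsionLayers K (TorsionArrangement.baseChange RS c) δ) ∧
      ∃ e : TorsionArrangement.torsionLayers K c (δ.comap (algebraMap R RS)) ≃o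
          TorsionArrangement.torsionLayers K (TorsionArrangement.baseChange RS c) δ,
        ∀ Z : TorsionArrangement.torsionLayers K c (δ.comap (algebraMap R RS)),
          (e Z : TorsionArrangement.layers K (TorsionArrangement.baseChange RS c)) =
            TorsionArrangement.layerMap RS c (Z : TorsionArrangement.layers K c)) ∧
    Nonempty (TorsionArrangement.layers K (TorsionArrangement.baseChange RS c) ≃o
      TorsionArrangement.torsionLayers K c
        (((TorsionArrangement.lcmPeriod c).map (algebraMap R RS)).comap (algebraMap R RS))) := by
  have h0 : S ≤ nonZeroDivisors R := le_nonZeroDivisors_of_noZeroDivisors hS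
  have : IsDomain RS := IsLocalization.isDomain_of_le_nonZeroDivisors RS h0
  have : IsFractionRing RS K := IsFractionRing.isFractionRing_of_isDomain_of_isLocalization S RS K
  have : IsNoetherianRing RS := IsLocalization.isNoetherianRing S RS inferInstance
  constructor
  · intro δ hδ
    have hδ0 : δ ≠ ⊥ := by
      rintro rfl
      exact TorsionArrangement.lcmPeriod_ne_bot (TorsionArrangement.baseChange RS c)
        (zero_dvd_iff.1 hδ)
    have hfin := TorsionArrangement.finite_torsionLayers (K := K) c
      (TorsionArrangement.comap_ne_bot S hδ0)
    obtain ⟨e, he⟩ := TorsionArrangement.exists_orderIso_torsionLayers (K := K) c S hRS hδ0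
    exact ⟨hfin, Finite.of_equiv _ e.toEquiv, e, he⟩
  · have hρ : (TorsionArrangement.lcmPeriod c).map (algebraMap R RS) ≠ ⊥ := fun h =>
      TorsionArrangement.lcmPeriod_ne_bot c
        ((Ideal.map_eq_bot_iff_of_injective (IsLocalization.injective RS h0)).1 h)
    obtain ⟨e, -⟩ := TorsionArrangement.exists_orderIso_torsionLayers (K := K) c S hRS hρ
    rw [TorsionArrangement.torsionLayers_map_lcmPeriod c S] at e
    exact ⟨OrderIso.Set.univ.symm.trans e.symm⟩
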